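/- \textbf{Theorem B (Moderate deviations).} Let $k\ge 1$ and $\alpha\in(0,1)$, and let $(x_N)_{N\ge1}$ be a sequence of positive numbers with $\sqrt N/x_N\to0$ and $x_N/N^{1/(2-\alpha)}\to0$ as $N\to\infty$. Let $X_1,X_2,\dots$ be i.i.d. random vectors in $\mathbb R^k$ with $\mathbb E[X_1]=0$, and suppose that for some $c>0$ and all sufficiently large $t$, \[ \mathbb P(\|X_1\|\ge t)\le \exp(-c\,t^\alpha), \] where $\|\cdot\|$ is the Euclidean norm. Suppose that the covariance matrix $\Sigma=\operatorname{Cov}(X_1)$ is invertible. Put $Z_N=\frac1{x_N}\sum_{i=1}^N X_i$ and $I(z)=\frac12 z^\top\Sigma^{-1}z$ for $z\in\mathbb R^k$. Then $(Z_N)$ satisfies a large deviation principle on $\mathbb R^k$ with speed $x_N^2/N$ and good rate function $I$. That is, $x_N^2/N\to\infty$, all sublevel sets $\{z: I(z)\le y\}$, $y\in\mathbb R$, are compact, and \[ \liminf_{N\to\infty}\frac{N}{x_N^2}\log\mathbb P(Z_N\in O)\ge-\inf_{z\in O}I(z)\ \text{ for all open } O\subseteq\mathbb R^k, \qquad \limsup_{N\to\infty}\frac{N}{x_N^2}\log\mathbb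 P(Z_N\in C)\le-\inf_{z\in C}I(z)\ \text{ for all closed } C\subseteq\mathbb R^k, \] with the conventions $\log 0=-\infty$ and $\inf\emptyset=\infty$. In particular, for every $t\in(0,\infty)^k$, \[ \lim_{N\to\infty}\frac{N}{x_N^2}\log\mathbb P(Z_N\ge t)=-\inf_{z\ge t}\tfrac12 z^\top\Sigma^{-1}z, \] where $z\ge t$ means $z_j\ge t_j$ for all $j=1,\dots,k$. -/

import Mathlib

open MeasureTheory ProbabilityTheory Filter Topology
open scoped ENNReal Matrix

noncomputable section

namespace LargeDev

/-- `I : E → [0,∞]` is a rate function: all its sublevel sets are closed. -/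
def IsRateFunction {E : Type*} [TopologicalSpace E] (I : E → ℝ≥0∞) : Prop :=
  ∀ y : ℝ, IsClosed {x | (I x : EReal) ≤ (y : EReal)}

/-- A good rate function is a rate function all of whose sublevel sets are compact. -/
def IsGoodRateFunction {E : Type*} [TopologicalSpace E] (I : E → ℝ≥0∞) : Prop :=
  IsRateFunction I ∧ ∀ y : ℝ, IsCompact {x | (I x : EReal) ≤ (y : EReal)}

/-- The random elements `Z N` of the topological space `E`, defined on the probability space
`(Ω, P)`, satisfy a large deviation principle with speed `s N → ∞` and rate function `I`.
Logarithms take values in `[-∞, ∞]`, with `log 0 = -∞`, and infima over the empty set are `∞`. -/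
structure SatisfiesLDP {Ω E : Type*} [MeasurableSpace Ω] [TopologicalSpace E]
    (P : Measure Ω) (Z : ℕ → Ω → E) (s : ℕ → ℝ) (I : E → ℝ≥0∞) : Prop where
  tendsto_speed : Tendsto s atTop atTop
  isRateFunction : IsRateFunction I
  lower_bound : ∀ O : Set E, IsOpen O →
    -((⨅ x ∈ O, I x : ℝ≥0∞) : EReal) ≤
      liminf (fun N : ℕ => ((1 / s N : ℝ) : EReal) * ENNReal.log (P {ω | Z N ω ∈ O})) atTop
  upper_bound : ∀ C : Set E, IsClosed C →
    limsup (fun N : ℕ => ((1 / s N : ℝ) : EReal) * ENNReal.log (P {ω | Z N ω ∈ C})) atTop ≤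
      -((⨅ x ∈ C, I x : ℝ≥0∞) : EReal)

/-- The covariance matrix `Cov(Y)` of a random vector `Y` with values in `ℝ^k`. -/
def covMatrix {Ω : Type*} [MeasurableSpace Ω] {k : ℕ} (P : Measure Ω)
    (Y : Ω → EuclideanSpace ℝ (Fin k)) : Matrix (Fin k) (Fin k) ℝ :=
  Matrix.of fun i j => cov[fun ω => Y ω i, fun ω => Y ω j; P]

/-- The function `z ↦ (1/2) zᵀ S⁻¹ z` as a function with values in `[0,∞]`. It is used for
covariance matrices `S` only, where the quadratic form is nonnegative. -/
def gaussianRate {k : ℕ} (S : Matrix (Fin k) (Fin k) ℝ) (z : EuclideanSpace ℝ (Fin k)) : ℝ≥0∞ :=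
  ENNReal.ofReal (1 / 2 * (z.ofLp ⬝ᵥ (S⁻¹ *ᵥ z.ofLp)))

end LargeDev

end

/-!
Write `s = x ^ 2 / N` for the speed and `θ = x / N` for the natural tilt, so that
`s ⟪l, Z_N⟫ = θ ∑ ⟪l, X_i⟫`. The exponential moments of the `X_i` may be infinite, so the sums are
restricted to the event that `‖X_i‖ ≤ x` for all `i < N`. This event fails with probability at most
`N exp (-c x ^ α)`, which is negligible on the scale `exp (-s)` because
`x = o(N ^ (1 / (2 - α)))` means `s = o(x ^ α)`
(`eventually_measure_truncationEvent_compl_le`).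

On `‖X‖ ≤ x` the same condition gives `θ ‖X‖ ≤ θ x ^ (1 - α) ‖X‖ ^ α = o(1) ‖X‖ ^ α`, and
`‖X‖ ^ 2 exp (c / 2 ‖X‖ ^ α)` is integrable. Dominated convergence therefore yields the Taylor
expansion `𝔼[exp (θ ⟪l, X⟫); ‖X‖ ≤ x] = 1 + θ ^ 2 ⟪l, Σ l⟫ / 2 + o(θ ^ 2)`
(`tendsto_truncated_expMoment`). By independence its `N`-th power is the exponential moment of the
truncated sum, so the cumulant generating functions converge at speed `N θ ^ 2 = s` to the quadratic
form `½ ⟪l, Σ l⟫` (`hasQuadraticCumulantLimit_truncatedLaw`).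

A Gärtner–Ellis argument for quadratic limits then concludes. A closed set on which the rate exceeds
`b` is covered by finitely many half-spaces `{b < ⟪l, z⟫ - ½ ⟪l, Σ l⟫}`, each controlled by Chernoff's
bound; the directions `± e_j` take care of a neighbourhood of infinity
(`eventually_measure_closed_le`). Lower bounds follow by exponential tilting
(`eventually_le_measure_open`). For orthants `{z ≥ t}` with `t > 0`, scaling by `1 + η` moves the
closed orthant into its interior, so both bounds give the same infimum.
-/

namespace LargeDev

/-! ### Logarithmic asymptotics -/

theorem one_div_mul_log_ofReal_exp {s : ℝ} (hs : 0 < s) (b : ℝ) :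
    ((1 / s : ℝ) : EReal) * ENNReal.log (ENNReal.ofReal (Real.exp (s * b))) = (b : EReal) := by
  rw [ENNReal.log_ofReal_of_pos (Real.exp_pos _), Real.log_exp, ← EReal.coe_mul]
  congr 1
  field_simp

theorem le_one_div_mul_log {s : ℝ} (hs : 0 < s) {b : ℝ} {p : ℝ≥0∞}
    (h : ENNReal.ofReal (Real.exp (s * b)) ≤ p) :
    (b : EReal) ≤ ((1 / s : ℝ) : EReal) * ENNReal.log p := by
  rw [← one_div_mul_log_ofReal_exp hs b]
  exact mul_le_mul_of_nonneg_left (ENNReal.log_monotone h)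
    (EReal.coe_nonneg.2 (one_div_pos.2 hs).le)

theorem one_div_mul_log_le {s : ℝ} (hs : 0 < s) {b : ℝ} {p : ℝ≥0∞}
    (h : p ≤ ENNReal.ofReal (Real.exp (s * b))) :
    ((1 / s : ℝ) : EReal) * ENNReal.log p ≤ (b : EReal) := by
  rw [← one_div_mul_log_ofReal_exp hs b]
  exact mul_le_mul_of_nonneg_left (ENNReal.log_monotone h)
    (EReal.coe_nonneg.2 (one_div_pos.2 hs).le)

/-- Exponential lower bounds at the individual points of `A` combine into the lower bound of a
large deviation principle, with the infimum of the rate over `A`. -/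
theorem neg_iInf_le_liminf {E : Type*} {A : Set E} {q : E → ℝ} {s : ℕ → ℝ} {p : ℕ → ℝ≥0∞}
    (hs : Tendsto s atTop atTop)
    (h : ∀ z ∈ A, ∀ ε > 0, ∀ᶠ N in atTop, ENNReal.ofReal (Real.exp (s N * -(q z + ε))) ≤ p N) :
    -((⨅ z ∈ A, ENNReal.ofReal (q z) : ℝ≥0∞) : EReal) ≤
      liminf (fun N => ((1 / s N : ℝ) : EReal) * ENNReal.log (p N)) atTop := by
  set L := liminf (fun N => ((1 / s N : ℝ) : EReal) * ENNReal.log (p N)) atTop with hL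
  have key : ∀ z ∈ A, -L ≤ (q z : EReal) := by
    intro z hz
    refine EReal.le_of_forall_lt_iff_le.1 fun r hr => EReal.neg_le_of_neg_le ?_
    rw [← EReal.coe_neg]
    refine le_liminf_of_le (by isBoundedDefault) ?_
    filter_upwards [h z hz (r - q z) (sub_pos.2 (EReal.coe_lt_coe_iff.1 hr)),
      hs.eventually_gt_atTop 0] with N hN hsN
    refine le_one_div_mul_log hsN ?_
    rwa [add_sub_cancel] at hN
  refine EReal.neg_le_of_neg_le (((le_max_right 0 _).trans_eq
    EReal.coe_toENNReal_eq_max.symm).trans ?_)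
  refine EReal.coe_ennreal_le_coe_ennreal_iff.2 (le_iInf₂ fun z hz => ?_)
  exact (EReal.toENNReal_le_toENNReal (key z hz)).trans_eq
    (EReal.toENNReal_of_ne_top (EReal.coe_ne_top _))

/-- Exponential upper bounds at every rate below the infimum over `A` combine into the upper bound
of a large deviation principle. -/
theorem limsup_le_neg_iInf {E : Type*} {A : Set E} {q : E → ℝ} (hq : ∀ z, 0 ≤ q z) {s : ℕ → ℝ}
    {p : ℕ → ℝ≥0∞} (hs : Tendsto s atTop atTop)
    (h : ∀ b b', b' < b → (∀ z ∈ A, b < q z) →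
      ∀ᶠ N in atTop, p N ≤ ENNReal.ofReal (Real.exp (s N * -b'))) :
    limsup (fun N => ((1 / s N : ℝ) : EReal) * ENNReal.log (p N)) atTop ≤
      -((⨅ z ∈ A, ENNReal.ofReal (q z) : ℝ≥0∞) : EReal) := by
  refine EReal.le_of_forall_lt_iff_le.1 fun r hr => ?_
  obtain ⟨b, hb1, hb2⟩ := EReal.exists_between_coe_real (EReal.neg_lt_comm.1 hr)
  rw [← EReal.coe_neg, EReal.coe_lt_coe_iff] at hb1
  have hA : ∀ z ∈ A, b < q z := by
    intro z hz
    have := hb2.trans_le (EReal.coe_ennreal_le_coe_ennreal_iff.2 (iInf₂_le z hz))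
    rwa [EReal.coe_ennreal_ofReal, max_eq_left (hq z), EReal.coe_lt_coe_iff] at this
  refine limsup_le_of_le (by isBoundedDefault) ?_
  filter_upwards [h b (-r) hb1 hA, hs.eventually_gt_atTop 0] with N hN hsN
  refine one_div_mul_log_le hsN ?_
  rwa [neg_neg] at hN

/-! ### The quadratic rate and its conjugate -/

section Quadratic

variable {k : ℕ} {S : Matrix (Fin k) (Fin k) ℝ}

theorem quadratic_nonneg (hS : S.PosSemidef) (l : Fin k → ℝ) : 0 ≤ l ⬝ᵥ (S *ᵥ l) := by
  simpa using hS.dotProduct_mulVec_nonneg l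

theorem dotProduct_mulVec_symm (hS : S.PosSemidef) (u v : Fin k → ℝ) :
    u ⬝ᵥ (S *ᵥ v) = v ⬝ᵥ (S *ᵥ u) := by
  have hT : Sᵀ = S := by simpa using hS.isHermitian.eq
  rw [Matrix.dotProduct_mulVec, ← Matrix.mulVec_transpose, hT, dotProduct_comm]

theorem mulVec_inv_mulVec (hu : IsUnit S) (z : Fin k → ℝ) : S *ᵥ (S⁻¹ *ᵥ z) = z := by
  rw [Matrix.mulVec_mulVec, Matrix.mul_nonsing_inv _ ((Matrix.isUnit_iff_isUnit_det S).1 hu),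
    Matrix.one_mulVec]

theorem half_inv_quadratic_eq (hu : IsUnit S) (z : Fin k → ℝ) :
    (S⁻¹ *ᵥ z) ⬝ᵥ z - 1 / 2 * ((S⁻¹ *ᵥ z) ⬝ᵥ (S *ᵥ (S⁻¹ *ᵥ z))) = 1 / 2 * (z ⬝ᵥ (S⁻¹ *ᵥ z)) := by
  rw [mulVec_inv_mulVec hu, dotProduct_comm]
  ring

/-- Fenchel–Young inequality for a quadratic form and its inverse. -/
theorem dotProduct_sub_le (hS : S.PosSemidef) (hu : IsUnit S) (l z : Fin k → ℝ) :
    l ⬝ᵥ z - 1 / 2 * (l ⬝ᵥ (S *ᵥ l)) ≤ 1 / 2 * (z ⬝ᵥ (S⁻¹ *ᵥ z)) := by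
  have h := quadratic_nonneg hS (l - S⁻¹ *ᵥ z)
  have h1 := dotProduct_mulVec_symm hS (S⁻¹ *ᵥ z) l
  rw [Matrix.mulVec_sub, mulVec_inv_mulVec hu, sub_dotProduct, dotProduct_sub, dotProduct_sub,
    h1, mulVec_inv_mulVec hu, dotProduct_comm (S⁻¹ *ᵥ z) z] at h
  linarith

theorem inv_quadratic_nonneg (hS : S.PosSemidef) (hu : IsUnit S) (z : Fin k → ℝ) :
    0 ≤ 1 / 2 * (z ⬝ᵥ (S⁻¹ *ᵥ z)) := by
  simpa using dotProduct_sub_le hS hu 0 z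

theorem quadratic_add (hS : S.PosSemidef) (l m : Fin k → ℝ) :
    (l + m) ⬝ᵥ (S *ᵥ (l + m)) =
      l ⬝ᵥ (S *ᵥ l) + 2 * (m ⬝ᵥ (S *ᵥ l)) + m ⬝ᵥ (S *ᵥ m) := by
  rw [Matrix.mulVec_add, add_dotProduct, dotProduct_add, dotProduct_add,
    dotProduct_mulVec_symm hS l m]
  ring

/-- The signed coordinate directions `± e_j`. -/
def signedBasis (i : Fin k × ℤˣ) : Fin k → ℝ := Pi.single i.1 ((i.2 : ℤ) : ℝ)

theorem exists_signedBasis_dotProduct (v : Fin k → ℝ) (j : Fin k) :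
    ∃ i : Fin k × ℤˣ, signedBasis i ⬝ᵥ v = |v j| := by
  rcases le_total 0 (v j) with h | h
  · exact ⟨(j, 1), by simp [signedBasis, abs_of_nonneg h]⟩
  · exact ⟨(j, -1), by simp [signedBasis, abs_of_nonpos h]⟩

theorem exists_quadratic_signedBasis_le (S : Matrix (Fin k) (Fin k) ℝ) :
    ∃ T : ℝ, 0 < T ∧ ∀ i : Fin k × ℤˣ, signedBasis i ⬝ᵥ (S *ᵥ signedBasis i) ≤ T := by
  refine ⟨1 + ∑ i : Fin k × ℤˣ, |signedBasis i ⬝ᵥ (S *ᵥ signedBasis i)|, by positivity,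
    fun i => (le_abs_self _).trans ?_⟩
  have := Finset.single_le_sum (f := fun i : Fin k × ℤˣ =>
    |signedBasis i ⬝ᵥ (S *ᵥ signedBasis i)|) (fun _ _ => abs_nonneg _) (Finset.mem_univ i)
  linarith

/-- The region on which every half-space `{b < ⟪d, z⟫ - ½ ⟪d, S d⟫}`, `d = ± e_j`, is avoided is
bounded. -/
theorem isBounded_of_signedBasis_le (S : Matrix (Fin k) (Fin k) ℝ) (b : ℝ) :
    Bornology.IsBounded {z : EuclideanSpace ℝ (Fin k) | ∀ i : Fin k × ℤˣ,
      signedBasis i ⬝ᵥ z.ofLp - 1 / 2 * (signedBasis i ⬝ᵥ (S *ᵥ signedBasis i)) ≤ b} := by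
  obtain ⟨T, -, hT⟩ := exists_quadratic_signedBasis_le S
  have hsub : Bornology.IsBounded (Metric.closedBall (0 : Fin k → ℝ) (|b| + |T|)) :=
    Metric.isBounded_closedBall
  have := (PiLp.antilipschitzWith_ofLp 2 (fun _ : Fin k => ℝ)).isBounded_preimage hsub
  refine this.subset fun z hz => ?_
  rw [Set.mem_preimage, mem_closedBall_zero_iff, pi_norm_le_iff_of_nonneg (by positivity)]
  intro j
  obtain ⟨i, hi⟩ := exists_signedBasis_dotProduct z.ofLp j
  have h1 := hz i
  rw [hi] at h1
  have h2 := hT i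
  have h3 := le_abs_self b
  have h4 := le_abs_self T
  have h5 := abs_nonneg T
  rw [Real.norm_eq_abs]
  linarith

theorem continuous_dotProduct_ofLp (l : Fin k → ℝ) :
    Continuous fun z : EuclideanSpace ℝ (Fin k) => l ⬝ᵥ z.ofLp := by
  unfold dotProduct
  fun_prop

theorem continuous_inv_quadratic (S : Matrix (Fin k) (Fin k) ℝ) :
    Continuous fun z : EuclideanSpace ℝ (Fin k) => 1 / 2 * (z.ofLp ⬝ᵥ (S⁻¹ *ᵥ z.ofLp)) := by
  unfold Matrix.mulVec dotProduct
  fun_prop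

theorem isGoodRateFunction_gaussianRate (hS : S.PosSemidef) (hu : IsUnit S) :
    IsGoodRateFunction (gaussianRate S) := by
  have hset : ∀ y : ℝ, {z : EuclideanSpace ℝ (Fin k) | (gaussianRate S z : EReal) ≤ (y : EReal)} =
      {z | 1 / 2 * (z.ofLp ⬝ᵥ (S⁻¹ *ᵥ z.ofLp)) ≤ y} := by
    intro y
    ext z
    rw [Set.mem_ofPred_eq, Set.mem_ofPred_eq, gaussianRate, EReal.coe_ennreal_ofReal,
      max_eq_left (inv_quadratic_nonneg hS hu _), EReal.coe_le_coe_iff]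
  have hcl : ∀ y : ℝ, IsClosed {z : EuclideanSpace ℝ (Fin k) |
      (gaussianRate S z : EReal) ≤ (y : EReal)} := fun y => by
    rw [hset]
    exact isClosed_le (continuous_inv_quadratic S) continuous_const
  refine ⟨hcl, fun y => Metric.isCompact_of_isClosed_isBounded (hcl y) ?_⟩
  rw [hset]
  exact (isBounded_of_signedBasis_le S y).subset fun z hz i =>
    (dotProduct_sub_le hS hu _ _).trans hz

end Quadratic

/-! ### Large deviations from a quadratic limiting cumulant generating function -/

section GartnerEllis

variable {k : ℕ}

/-- The exponential moment `∫ exp (s ⟪l, z⟫) dμ(z)`, with values in `[0, ∞]`. -/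
noncomputable def expMoment (μ : Measure (EuclideanSpace ℝ (Fin k))) (s : ℝ) (l : Fin k → ℝ) : ℝ≥0∞ :=
  ∫⁻ z, ENNReal.ofReal (Real.exp (s * (l ⬝ᵥ z.ofLp))) ∂μ

/-- The measures `ν N` have, at speed `s N`, the limiting cumulant generating function
`l ↦ ½ ⟪l, S l⟫`: this is `(1 / s N) log (∫ exp (s N ⟪l, z⟫) dν_N(z)) → ½ ⟪l, S l⟫` for all `l`,
written without logarithms. The measures need not be normalized. -/
def HasQuadraticCumulantLimit (S : Matrix (Fin k) (Fin k) ℝ)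
    (ν : ℕ → Measure (EuclideanSpace ℝ (Fin k))) (s : ℕ → ℝ) : Prop :=
  ∀ l : Fin k → ℝ, ∀ ε > 0, ∀ᶠ N in atTop,
    ENNReal.ofReal (Real.exp (s N * (1 / 2 * (l ⬝ᵥ (S *ᵥ l)) - ε))) ≤ expMoment (ν N) (s N) l ∧
    expMoment (ν N) (s N) l ≤ ENNReal.ofReal (Real.exp (s N * (1 / 2 * (l ⬝ᵥ (S *ᵥ l)) + ε)))

theorem measurable_exp_dotProduct (s : ℝ) (l : Fin k → ℝ) :
    Measurable fun z : EuclideanSpace ℝ (Fin k) =>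
      ENNReal.ofReal (Real.exp (s * (l ⬝ᵥ z.ofLp))) :=
  (ENNReal.continuous_ofReal.comp (Real.continuous_exp.comp
    (continuous_const.mul (continuous_dotProduct_ofLp l)))).measurable

/-- Chernoff bound for an exponentially tilted measure. -/
theorem setLIntegral_exp_halfspace_le (μ : Measure (EuclideanSpace ℝ (Fin k))) {s : ℝ} (hs : 0 ≤ s)
    (l m : Fin k → ℝ) (r : ℝ) :
    ∫⁻ z in {z | r ≤ m ⬝ᵥ z.ofLp}, ENNReal.ofReal (Real.exp (s * (l ⬝ᵥ z.ofLp))) ∂μ ≤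
      ENNReal.ofReal (Real.exp (s * -r)) * expMoment μ s (l + m) := by
  rw [expMoment, ← lintegral_const_mul _ (measurable_exp_dotProduct s (l + m))]
  refine (setLIntegral_mono' (isClosed_le continuous_const
    (continuous_dotProduct_ofLp m)).measurableSet fun z hz => ?_).trans (setLIntegral_le_lintegral _ _)
  rw [← ENNReal.ofReal_mul (Real.exp_pos _).le, ← Real.exp_add, add_dotProduct]
  refine ENNReal.ofReal_le_ofReal (Real.exp_le_exp.2 ?_)
  have := mul_le_mul_of_nonneg_left (show r ≤ m ⬝ᵥ z.ofLp from hz) hs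
  linarith

variable {S : Matrix (Fin k) (Fin k) ℝ} {ν : ℕ → Measure (EuclideanSpace ℝ (Fin k))} {s : ℕ → ℝ}

theorem eventually_measure_halfspace_le (hs : Tendsto s atTop atTop)
    (hν : HasQuadraticCumulantLimit S ν s) (l : Fin k → ℝ) {b b' : ℝ} (hb : b' < b) :
    ∀ᶠ N in atTop, ν N {z | b < l ⬝ᵥ z.ofLp - 1 / 2 * (l ⬝ᵥ (S *ᵥ l))} ≤
      ENNReal.ofReal (Real.exp (s N * -b')) := by
  filter_upwards [hν l (b - b') (sub_pos.2 hb), hs.eventually_ge_atTop 0] with N hN hsN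
  have h := setLIntegral_exp_halfspace_le (ν N) hsN 0 l (b + 1 / 2 * (l ⬝ᵥ (S *ᵥ l)))
  simp only [zero_dotProduct, mul_zero, Real.exp_zero, ENNReal.ofReal_one, lintegral_const,
    Measure.restrict_apply_univ, one_mul, zero_add] at h
  refine (measure_mono fun z hz => ?_).trans (h.trans ((mul_le_mul_right hN.2 _).trans_eq ?_))
  · have : b < l ⬝ᵥ z.ofLp - 1 / 2 * (l ⬝ᵥ (S *ᵥ l)) := hz
    show b + 1 / 2 * (l ⬝ᵥ (S *ᵥ l)) ≤ l ⬝ᵥ z.ofLp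
    linarith
  · rw [← ENNReal.ofReal_mul (Real.exp_pos _).le, ← Real.exp_add]
    congr 2
    ring

theorem eventually_const_mul_exp_le (hs : Tendsto s atTop atTop) (K : ℝ) {b b' : ℝ} (hb : b' < b) :
    ∀ᶠ N in atTop, K * Real.exp (s N * -b) ≤ Real.exp (s N * -b') := by
  have h : Tendsto (fun N => Real.exp (s N * (b - b'))) atTop atTop :=
    Real.tendsto_exp_atTop.comp (hs.atTop_mul_const (sub_pos.2 hb))
  filter_upwards [h.eventually_ge_atTop K] with N hN
  calc K * Real.exp (s N * -b) ≤ Real.exp (s N * (b - b')) * Real.exp (s N * -b) := by gcongr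
    _ = Real.exp (s N * -b') := by rw [← Real.exp_add]; congr 1; ring

theorem eventually_measure_closed_le (hu : IsUnit S)
    (hs : Tendsto s atTop atTop) (hν : HasQuadraticCumulantLimit S ν s)
    {C : Set (EuclideanSpace ℝ (Fin k))} (hC : IsClosed C) {b b' : ℝ} (hb : b' < b)
    (hbC : ∀ z ∈ C, b < 1 / 2 * (z.ofLp ⬝ᵥ (S⁻¹ *ᵥ z.ofLp))) :
    ∀ᶠ N in atTop, ν N C ≤ ENNReal.ofReal (Real.exp (s N * -b')) := by
  classical
  set U : (Fin k → ℝ) → Set (EuclideanSpace ℝ (Fin k)) :=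
    fun l => {z | b < l ⬝ᵥ z.ofLp - 1 / 2 * (l ⬝ᵥ (S *ᵥ l))} with hU
  have hUo : ∀ l, IsOpen (U l) := fun l =>
    isOpen_lt continuous_const ((continuous_dotProduct_ofLp l).sub continuous_const)
  set B : Set (EuclideanSpace ℝ (Fin k)) := {z | ∀ i : Fin k × ℤˣ,
    signedBasis i ⬝ᵥ z.ofLp - 1 / 2 * (signedBasis i ⬝ᵥ (S *ᵥ signedBasis i)) ≤ b} with hB
  have hBc : IsClosed B := by
    rw [hB, Set.ofPred_forall]
    exact isClosed_iInter fun i =>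
      isClosed_le ((continuous_dotProduct_ofLp _).sub continuous_const) continuous_const
  have hK : IsCompact (C ∩ B) := Metric.isCompact_of_isClosed_isBounded (hC.inter hBc)
    ((isBounded_of_signedBasis_le S b).subset Set.inter_subset_right)
  obtain ⟨t, ht⟩ := hK.elim_finite_subcover U hUo fun z hz => by
    refine Set.mem_iUnion.2 ⟨S⁻¹ *ᵥ z.ofLp, ?_⟩
    show b < _
    rw [half_inv_quadratic_eq hu]
    exact hbC z hz.1
  have hcov : C ⊆ ⋃ l ∈ t ∪ Finset.univ.image signedBasis, U l := by
    intro z hz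
    by_cases hzB : z ∈ B
    · obtain ⟨l, hl, hzl⟩ := Set.mem_iUnion₂.1 (ht ⟨hz, hzB⟩)
      exact Set.mem_iUnion₂.2 ⟨l, Finset.mem_union_left _ hl, hzl⟩
    · have : ∃ i : Fin k × ℤˣ, b < signedBasis i ⬝ᵥ z.ofLp -
          1 / 2 * (signedBasis i ⬝ᵥ (S *ᵥ signedBasis i)) := by
        by_contra! hcon
        exact hzB hcon
      obtain ⟨i, hi⟩ := this
      exact Set.mem_iUnion₂.2 ⟨signedBasis i, Finset.mem_union_right _
        (Finset.mem_image_of_mem _ (Finset.mem_univ i)), hi⟩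
  set T := t ∪ Finset.univ.image signedBasis
  obtain ⟨b₁, hb₁, hb₂⟩ := exists_between hb
  have hall : ∀ᶠ N in atTop, ∀ l ∈ T, ν N (U l) ≤ ENNReal.ofReal (Real.exp (s N * -b₁)) :=
    (Filter.eventually_all_finset T).2 fun l _ => eventually_measure_halfspace_le hs hν l hb₂
  filter_upwards [hall, eventually_const_mul_exp_le hs T.card hb₁] with N hN hN2
  calc ν N C ≤ ν N (⋃ l ∈ T, U l) := measure_mono hcov
    _ ≤ ∑ l ∈ T, ν N (U l) := measure_biUnion_finset_le _ _
    _ ≤ ∑ _l ∈ T, ENNReal.ofReal (Real.exp (s N * -b₁)) := Finset.sum_le_sum hN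
    _ = ENNReal.ofReal (T.card * Real.exp (s N * -b₁)) := by
      rw [Finset.sum_const, nsmul_eq_mul, ENNReal.ofReal_mul (by positivity),
        ENNReal.ofReal_natCast]
    _ ≤ _ := ENNReal.ofReal_le_ofReal hN2

/-- The lower bound. Tilting by `l = S⁻¹ z₀` recentres the measures at `z₀`: under the tilted
measures every half-space `{δ ≤ ± (z - z₀)_j}` is exponentially negligible by Chernoff's bound with
a small extra tilt `± t e_j`, so that the tilted mass concentrates near `z₀`, where the tilting
density is nearly constant. -/
theorem eventually_le_measure_open (hS : S.PosSemidef) (hu : IsUnit S)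
    (hs : Tendsto s atTop atTop) (hν : HasQuadraticCumulantLimit S ν s)
    {O : Set (EuclideanSpace ℝ (Fin k))} (hO : IsOpen O) {z₀ : EuclideanSpace ℝ (Fin k)}
    (hz₀ : z₀ ∈ O) {ε : ℝ} (hε : 0 < ε) :
    ∀ᶠ N in atTop, ENNReal.ofReal
      (Real.exp (s N * -(1 / 2 * (z₀.ofLp ⬝ᵥ (S⁻¹ *ᵥ z₀.ofLp)) + ε))) ≤ ν N O := by
  set l : Fin k → ℝ := S⁻¹ *ᵥ z₀.ofLp with hl
  have hSl : S *ᵥ l = z₀.ofLp := mulVec_inv_mulVec hu _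
  set a : ℝ := 1 / 2 * (z₀.ofLp ⬝ᵥ l) with ha
  have hlz : l ⬝ᵥ z₀.ofLp = 2 * a := by rw [dotProduct_comm, ha]; ring
  have hlS : 1 / 2 * (l ⬝ᵥ (S *ᵥ l)) = a := by rw [hSl, hlz]; ring
  -- Near `z₀` the tilting exponent is at most its value at `z₀`, up to `ε / 2`.
  set O' : Set (EuclideanSpace ℝ (Fin k)) := O ∩ {z | l ⬝ᵥ z.ofLp < 2 * a + ε / 2} with hO'
  have hO'o : IsOpen O' := hO.inter (isOpen_lt (continuous_dotProduct_ofLp l) continuous_const)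
  have hz₀' : z₀ ∈ O' := ⟨hz₀, by show l ⬝ᵥ z₀.ofLp < _; rw [hlz]; linarith⟩
  obtain ⟨δ, hδ, hball⟩ : ∃ δ > 0, ∀ z : EuclideanSpace ℝ (Fin k),
      (∀ i, signedBasis i ⬝ᵥ (z.ofLp - z₀.ofLp) < δ) → z ∈ O' := by
    have hpre : IsOpen ((fun v : Fin k → ℝ => WithLp.toLp 2 v) ⁻¹' O') :=
      hO'o.preimage (PiLp.continuous_toLp 2 _)
    obtain ⟨δ, hδ, hsub⟩ := Metric.isOpen_iff.1 hpre z₀.ofLp (by simpa using hz₀')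
    refine ⟨δ, hδ, fun z hz => ?_⟩
    have hmem : z.ofLp ∈ Metric.ball z₀.ofLp δ := by
      rw [mem_ball_iff_norm, pi_norm_lt_iff hδ]
      intro j
      obtain ⟨i, hi⟩ := exists_signedBasis_dotProduct (z.ofLp - z₀.ofLp) j
      rw [Real.norm_eq_abs, ← hi]
      exact hz i
    simpa using hsub hmem
  obtain ⟨T, hT, hTS⟩ := exists_quadratic_signedBasis_le S
  -- The exponential cost of a deviation `δ` in a direction `± e_j` is at least `g`.
  set t : ℝ := δ / T with ht
  set g : ℝ := δ ^ 2 / (2 * T) with hg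
  have htpos : 0 < t := div_pos hδ hT
  have hgpos : 0 < g := by positivity
  have hcost : ∀ i : Fin k × ℤˣ,
      1 / 2 * ((l + t • signedBasis i) ⬝ᵥ (S *ᵥ (l + t • signedBasis i))) -
        (t * (signedBasis i ⬝ᵥ z₀.ofLp) + t * δ) ≤ a - g := by
    intro i
    rw [quadratic_add hS, hSl, Matrix.mulVec_smul, smul_dotProduct, smul_dotProduct,
      dotProduct_smul, hlz]
    simp only [smul_eq_mul]
    have h1 : 1 / 2 * (t * (t * (signedBasis i ⬝ᵥ (S *ᵥ signedBasis i)))) ≤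
        1 / 2 * (t * (t * T)) := by
      have := hTS i
      gcongr
    have h2 : 1 / 2 * (t * (t * T)) - t * δ = -g := by
      rw [ht, hg]; field_simp; ring
    linarith
  set η : ℝ := min (g / 4) (ε / 4) with hη
  have hηpos : 0 < η := lt_min (by linarith) (by linarith)
  have hηg : η ≤ g / 4 := min_le_left _ _
  have hηε : η ≤ ε / 4 := min_le_right _ _
  have hall : ∀ᶠ N in atTop, ∀ i : Fin k × ℤˣ,
      expMoment (ν N) (s N) (l + t • signedBasis i) ≤ ENNReal.ofReal (Real.exp (s N *
        (1 / 2 * ((l + t • signedBasis i) ⬝ᵥ (S *ᵥ (l + t • signedBasis i))) + η))) :=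
    eventually_all.2 fun i => (hν _ η hηpos).mono fun N hN => hN.2
  filter_upwards [hall, hν l η hηpos, hs.eventually_ge_atTop 0,
    eventually_const_mul_exp_le hs (4 * (Fintype.card (Fin k × ℤˣ) : ℝ))
      (b := -(a - η - g / 4)) (b' := -(a - η)) (by linarith),
    eventually_const_mul_exp_le hs 4 (b := -(a - η - ε / 8)) (b' := -(a - η)) (by linarith)]
    with N hNall hNl hsN hN1 hN2
  simp only [neg_neg] at hN1 hN2
  refine le_trans ?_ (measure_mono (Set.inter_subset_left : O' ⊆ O))
  by_contra! hlt
  have hf := measurable_exp_dotProduct (k := k) (s N) l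
  have hin : ∫⁻ z in O', ENNReal.ofReal (Real.exp (s N * (l ⬝ᵥ z.ofLp))) ∂(ν N) ≤
      ENNReal.ofReal (Real.exp (s N * (a - ε / 2))) := by
    calc _ ≤ ∫⁻ _z in O', ENNReal.ofReal (Real.exp (s N * (2 * a + ε / 2))) ∂(ν N) := by
          refine setLIntegral_mono' hO'o.measurableSet fun z hz => ?_
          refine ENNReal.ofReal_le_ofReal (Real.exp_le_exp.2 ?_)
          exact mul_le_mul_of_nonneg_left (le_of_lt hz.2) hsN
      _ = ENNReal.ofReal (Real.exp (s N * (2 * a + ε / 2))) * ν N O' := by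
          rw [setLIntegral_const]
      _ ≤ ENNReal.ofReal (Real.exp (s N * (2 * a + ε / 2))) *
          ENNReal.ofReal (Real.exp (s N * -(a + ε))) := by gcongr
      _ = _ := by
          rw [← ENNReal.ofReal_mul (Real.exp_pos _).le, ← Real.exp_add]
          congr 2; ring
  have hout : ∫⁻ z in O'ᶜ, ENNReal.ofReal (Real.exp (s N * (l ⬝ᵥ z.ofLp))) ∂(ν N) ≤
      ENNReal.ofReal ((Fintype.card (Fin k × ℤˣ) : ℝ) * Real.exp (s N * (a - g + η))) := by
    set H : Fin k × ℤˣ → Set (EuclideanSpace ℝ (Fin k)) := fun i =>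
      {z | t * (signedBasis i ⬝ᵥ z₀.ofLp) + t * δ ≤ (t • signedBasis i) ⬝ᵥ z.ofLp} with hH
    have hsub : O'ᶜ ⊆ ⋃ i, H i := by
      intro z hz
      have : ∃ i, δ ≤ signedBasis i ⬝ᵥ (z.ofLp - z₀.ofLp) := by
        by_contra! hcon
        exact hz (hball z hcon)
      obtain ⟨i, hi⟩ := this
      refine Set.mem_iUnion.2 ⟨i, ?_⟩
      show t * _ + t * δ ≤ (t • signedBasis i) ⬝ᵥ z.ofLp
      rw [dotProduct_sub] at hi
      rw [smul_dotProduct, smul_eq_mul, ← mul_add]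
      exact mul_le_mul_of_nonneg_left (by linarith) htpos.le
    calc _ ≤ ∫⁻ z in ⋃ i, H i,
            ENNReal.ofReal (Real.exp (s N * (l ⬝ᵥ z.ofLp))) ∂(ν N) :=
          lintegral_mono_set hsub
      _ ≤ ∑ i : Fin k × ℤˣ, ∫⁻ z in H i,
            ENNReal.ofReal (Real.exp (s N * (l ⬝ᵥ z.ofLp))) ∂(ν N) :=
          (lintegral_iUnion_le _ _).trans_eq (tsum_fintype _)
      _ ≤ ∑ _i : Fin k × ℤˣ, ENNReal.ofReal (Real.exp (s N * (a - g + η))) := by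
          refine Finset.sum_le_sum fun i _ => ?_
          refine (setLIntegral_exp_halfspace_le (ν N) hsN l (t • signedBasis i) _).trans ?_
          refine (mul_le_mul_right (hNall i) _).trans ?_
          rw [← ENNReal.ofReal_mul (Real.exp_pos _).le, ← Real.exp_add, ← mul_add]
          refine ENNReal.ofReal_le_ofReal (Real.exp_le_exp.2 ?_)
          exact mul_le_mul_of_nonneg_left (by linarith [hcost i]) hsN
      _ = _ := by
          rw [Finset.sum_const, nsmul_eq_mul, ENNReal.ofReal_mul (by positivity),
            ENNReal.ofReal_natCast, Finset.card_univ]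
  have htot : ENNReal.ofReal (Real.exp (s N * (a - η))) ≤ ENNReal.ofReal
      (Real.exp (s N * (a - ε / 2)) +
        (Fintype.card (Fin k × ℤˣ) : ℝ) * Real.exp (s N * (a - g + η))) := by
    rw [ENNReal.ofReal_add (Real.exp_pos _).le (by positivity)]
    refine le_trans ?_ (add_le_add hin hout)
    rw [lintegral_add_compl _ hO'o.measurableSet]
    have := hNl.1
    rwa [hlS] at this
  rw [ENNReal.ofReal_le_ofReal_iff (by positivity)] at htot
  have h1 : Real.exp (s N * (a - ε / 2)) ≤ Real.exp (s N * (a - η - ε / 8)) :=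
    Real.exp_le_exp.2 (mul_le_mul_of_nonneg_left (by linarith) hsN)
  have h2 : (Fintype.card (Fin k × ℤˣ) : ℝ) * Real.exp (s N * (a - g + η)) ≤
      (Fintype.card (Fin k × ℤˣ) : ℝ) * Real.exp (s N * (a - η - g / 4)) := by
    have := mul_le_mul_of_nonneg_left (show a - g + η ≤ a - η - g / 4 by linarith) hsN
    gcongr
  have h3 := Real.exp_pos (s N * (a - η))
  linarith

end GartnerEllis

/-! ### Moments of stretched exponential tails -/

theorem integrable_of_measureReal_le_rpow {Ω : Type*} [MeasurableSpace Ω] {P : Measure Ω}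
    [IsProbabilityMeasure P] {f : Ω → ℝ} (hf : Measurable f) (hf0 : ∀ ω, 0 ≤ f ω) {A p : ℝ}
    (hA : 0 < A) (hp : 1 < p) (h : ∀ t, A < t → P.real {ω | t ≤ f ω} ≤ t ^ (-p)) :
    Integrable f P := by
  refine ⟨hf.aestronglyMeasurable, ?_⟩
  rw [hasFiniteIntegral_iff_ofReal (Eventually.of_forall hf0),
    lintegral_eq_lintegral_meas_le P (Eventually.of_forall hf0) hf.aemeasurable,
    ← Set.Ioc_union_Ioi_eq_Ioi hA.le]
  refine (lintegral_union_le _ _ _).trans_lt (ENNReal.add_lt_top.2 ⟨?_, ?_⟩)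
  · refine (lintegral_mono (g := fun _ => 1) fun t => prob_le_one).trans_lt ?_
    simp
  · have hint : IntegrableOn (fun t : ℝ => t ^ (-p)) (Set.Ioi A) :=
      integrableOn_Ioi_rpow_of_lt (by linarith) hA
    refine (setLIntegral_mono' measurableSet_Ioi fun t ht => ?_).trans_lt
      (hint.lintegral_lt_top)
    rw [← ofReal_measureReal]
    exact ENNReal.ofReal_le_ofReal (h t ht)

/-- Stretched exponentials dominate squares. -/
theorem exists_sq_le_const_mul_exp {α δ : ℝ} (hα : 0 < α) (hδ : 0 < δ) :
    ∃ C : ℝ, 0 < C ∧ ∀ r : ℝ, 0 ≤ r → r ^ 2 ≤ C * Real.exp (δ * r ^ α) := by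
  obtain ⟨m, hm⟩ := exists_nat_ge (2 / α)
  refine ⟨1 + m.factorial / δ ^ m, by positivity, fun r hr => ?_⟩
  have hE : 1 ≤ Real.exp (δ * r ^ α) := Real.one_le_exp (by positivity)
  have hF : 0 ≤ (m.factorial : ℝ) / δ ^ m * Real.exp (δ * r ^ α) := by positivity
  rcases le_total r 1 with h1 | h1
  · nlinarith
  · have h2 : r ^ 2 ≤ (r ^ α) ^ m := by
      rw [← Real.rpow_natCast (r ^ α) m, ← Real.rpow_mul hr, ← Real.rpow_natCast r 2]
      refine Real.rpow_le_rpow_of_exponent_le h1 ?_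
      rw [div_le_iff₀ hα] at hm
      push_cast
      linarith
    have h3 := Real.pow_div_factorial_le_exp (δ * r ^ α) (by positivity) m
    have h4 : (r ^ α) ^ m ≤ (m.factorial : ℝ) / δ ^ m * Real.exp (δ * r ^ α) := by
      calc (r ^ α) ^ m = (m.factorial : ℝ) / δ ^ m * ((δ * r ^ α) ^ m / m.factorial) := by
            rw [mul_pow]; field_simp
        _ ≤ _ := by gcongr
    linarith

theorem integrable_exp_mul_rpow_norm {Ω E : Type*} [MeasurableSpace Ω] {P : Measure Ω}
    [IsProbabilityMeasure P] [NormedAddCommGroup E] [MeasurableSpace E] [BorelSpace E]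
    {Y : Ω → E} (hY : Measurable Y)
    {α b c : ℝ} (hα : 0 < α) (hb : 0 < b) (hbc : b < c)
    (htail : ∀ᶠ t : ℝ in atTop, P.real {ω | t ≤ ‖Y ω‖} ≤ Real.exp (-c * t ^ α)) :
    Integrable (fun ω => Real.exp (b * ‖Y ω‖ ^ α)) P := by
  obtain ⟨T, hT⟩ := eventually_atTop.1 htail
  set T' := max T 0 with hT'
  have hT0 : 0 ≤ T' := le_max_right _ _
  refine integrable_of_measureReal_le_rpow (A := Real.exp (b * T' ^ α)) (p := c / b)
    (Real.measurable_exp.comp (measurable_const.mul (hY.norm.pow_const α)))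
    (fun ω => (Real.exp_pos _).le) (Real.exp_pos _) ((one_lt_div hb).2 hbc) fun t ht => ?_
  have ht0 : 0 < t := (Real.exp_pos _).trans ht
  have hlog : b * T' ^ α < Real.log t := (Real.lt_log_iff_exp_lt ht0).2 ht
  have hlog' : T' ^ α ≤ Real.log t / b := by
    rw [le_div_iff₀ hb]; linarith
  have hlog0 : 0 ≤ Real.log t / b := (Real.rpow_nonneg hT0 α).trans hlog'
  -- `τ` is the threshold of `‖Y‖` that corresponds to the threshold `t` of the exponential.
  set τ : ℝ := (Real.log t / b) ^ (1 / α) with hτ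
  have hτα : τ ^ α = Real.log t / b := by
    rw [hτ, ← Real.rpow_mul hlog0, one_div_mul_cancel hα.ne', Real.rpow_one]
  have hTτ : T' ≤ τ := by
    refine (Real.rpow_le_rpow_iff hT0 (Real.rpow_nonneg hlog0 _) hα).1 ?_
    rw [hτα]
    exact hlog'
  have hsub : {ω | t ≤ Real.exp (b * ‖Y ω‖ ^ α)} ⊆ {ω | τ ≤ ‖Y ω‖} := by
    intro ω hω
    have h1 : Real.log t ≤ b * ‖Y ω‖ ^ α := (Real.log_le_iff_le_exp ht0).2 hω
    have h2 : Real.log t / b ≤ ‖Y ω‖ ^ α := by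
      rw [div_le_iff₀ hb]; linarith
    rw [← hτα] at h2
    exact (Real.rpow_le_rpow_iff (hT0.trans hTτ) (norm_nonneg _) hα).1 h2
  calc P.real {ω | t ≤ Real.exp (b * ‖Y ω‖ ^ α)} ≤ P.real {ω | τ ≤ ‖Y ω‖} :=
        measureReal_mono hsub
    _ ≤ Real.exp (-c * τ ^ α) := hT τ ((le_max_left _ _).trans hTτ)
    _ = t ^ (-(c / b)) := by
        rw [hτα, Real.rpow_def_of_pos ht0]; congr 1; ring

theorem integrable_sq_mul_exp_rpow_norm {Ω E : Type*} [MeasurableSpace Ω] {P : Measure Ω}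
    [IsProbabilityMeasure P] [NormedAddCommGroup E] [MeasurableSpace E] [BorelSpace E]
    {Y : Ω → E} (hY : Measurable Y)
    {α b c : ℝ} (hα : 0 < α) (hb : 0 < b) (hbc : b < c)
    (htail : ∀ᶠ t : ℝ in atTop, P.real {ω | t ≤ ‖Y ω‖} ≤ Real.exp (-c * t ^ α)) :
    Integrable (fun ω => ‖Y ω‖ ^ 2 * Real.exp (b * ‖Y ω‖ ^ α)) P := by
  obtain ⟨b₁, hb₁, hb₁c⟩ := exists_between hbc
  obtain ⟨C, hC, hCr⟩ := exists_sq_le_const_mul_exp hα (sub_pos.2 hb₁)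
  refine ((integrable_exp_mul_rpow_norm hY hα (hb.trans hb₁) hb₁c htail).const_mul C).mono'
    ((hY.norm.pow_const 2).mul (Real.measurable_exp.comp
      (measurable_const.mul (hY.norm.pow_const α)))).aestronglyMeasurable
    (Eventually.of_forall fun ω => ?_)
  rw [Real.norm_of_nonneg (by positivity)]
  calc ‖Y ω‖ ^ 2 * Real.exp (b * ‖Y ω‖ ^ α)
      ≤ (C * Real.exp ((b₁ - b) * ‖Y ω‖ ^ α)) * Real.exp (b * ‖Y ω‖ ^ α) := by
        gcongr
        exact hCr _ (norm_nonneg _)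
    _ = C * Real.exp (b₁ * ‖Y ω‖ ^ α) := by
        rw [mul_assoc, ← Real.exp_add]; congr 2; ring

/-! ### Second-order expansion of truncated exponential moments -/

theorem abs_exp_sub_one_sub_le (v : ℝ) : |Real.exp v - 1 - v| ≤ v ^ 2 * Real.exp |v| := by
  have h := Complex.norm_exp_sub_sum_le_norm_mul_exp (v : ℂ) 2
  simp only [Finset.sum_range_succ, Finset.sum_range_zero, pow_zero, pow_one, Nat.factorial_zero,
    Nat.factorial_one, Nat.cast_one, div_one, zero_add, Complex.norm_real, Real.norm_eq_abs] at h
  rw [sq_abs] at h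
  calc |Real.exp v - 1 - v| = ‖Complex.exp v - (1 + v)‖ := by
        rw [← Real.norm_eq_abs, ← Complex.norm_real]; push_cast; congr 1; ring
    _ ≤ _ := h

theorem abs_exp_sub_one_sub_sub_sq_le (v : ℝ) :
    |Real.exp v - 1 - v - v ^ 2 / 2| ≤ |v| ^ 3 * Real.exp |v| := by
  have h := Complex.norm_exp_sub_sum_le_norm_mul_exp (v : ℂ) 3
  simp only [Finset.sum_range_succ, Finset.sum_range_zero, pow_zero, pow_one, Nat.factorial_zero,
    Nat.factorial_one, Nat.factorial_two, Nat.cast_one, Nat.cast_ofNat, div_one, zero_add,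
    Complex.norm_real, Real.norm_eq_abs] at h
  calc |Real.exp v - 1 - v - v ^ 2 / 2| = ‖Complex.exp v - (1 + v + v ^ 2 / 2)‖ := by
        rw [← Real.norm_eq_abs, ← Complex.norm_real]; push_cast; congr 1; ring
    _ ≤ _ := h

theorem tendsto_exp_second_order (u : ℝ) {θ : ℕ → ℝ} (hθ0 : ∀ᶠ N in atTop, 0 < θ N)
    (hθ : Tendsto θ atTop (𝓝 0)) :
    Tendsto (fun N => (Real.exp (θ N * u) - 1 - θ N * u) / θ N ^ 2) atTop (𝓝 (u ^ 2 / 2)) := by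
  rw [tendsto_iff_norm_sub_tendsto_zero]
  have hb : Tendsto (fun N => θ N * |u| ^ 3 * Real.exp (θ N * |u|)) atTop (𝓝 0) := by
    have h1 : Tendsto (fun N => θ N * |u| ^ 3 * Real.exp (θ N * |u|)) atTop
        (𝓝 (0 * |u| ^ 3 * Real.exp (0 * |u|))) :=
      (hθ.mul_const _).mul ((Real.continuous_exp.tendsto _).comp (hθ.mul_const _))
    simpa using h1
  refine squeeze_zero' (Eventually.of_forall fun N => norm_nonneg _) ?_ hb
  filter_upwards [hθ0] with N hN
  have h := abs_exp_sub_one_sub_sub_sq_le (θ N * u)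
  rw [abs_mul, abs_of_pos hN] at h
  have : (Real.exp (θ N * u) - 1 - θ N * u) / θ N ^ 2 - u ^ 2 / 2 =
      (Real.exp (θ N * u) - 1 - θ N * u - (θ N * u) ^ 2 / 2) / θ N ^ 2 := by
    field_simp
  rw [this, Real.norm_eq_abs, abs_div, abs_of_pos (pow_pos hN 2), div_le_iff₀ (pow_pos hN 2)]
  refine h.trans_eq ?_
  ring

theorem integrableOn_exp_of_norm_le {Ω E : Type*} [MeasurableSpace Ω] {P : Measure Ω}
    [IsProbabilityMeasure P] [NormedAddCommGroup E] [MeasurableSpace E] [BorelSpace E]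
    {Y : Ω → E} (hY : Measurable Y) {u : Ω → ℝ} (hu : Measurable u) {K : ℝ} (hK : 0 ≤ K)
    (huK : ∀ ω, |u ω| ≤ K * ‖Y ω‖) (θ r : ℝ) :
    IntegrableOn (fun ω => Real.exp (θ * u ω)) {ω | ‖Y ω‖ ≤ r} P := by
  refine Measure.integrableOn_of_bounded (M := Real.exp (|θ| * (K * r))) (measure_ne_top _ _)
    (Real.measurable_exp.comp (measurable_const.mul hu)).aestronglyMeasurable ?_
  refine (ae_restrict_iff' (measurableSet_le hY.norm measurable_const)).2
    (Eventually.of_forall fun ω hω => ?_)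
  rw [Real.norm_of_nonneg (Real.exp_pos _).le]
  refine Real.exp_le_exp.2 ((le_abs_self _).trans ?_)
  rw [abs_mul]
  exact mul_le_mul_of_nonneg_left ((huK ω).trans (mul_le_mul_of_nonneg_left hω hK))
    (abs_nonneg _)

/-- The exponential moment of `θ u` truncated to `‖Y‖ ≤ x` is `1 + θ² 𝔼[u²] / 2 + o(θ²)` for
centred `u` of at most linear growth in `Y`. On the truncation event `θ |u|` is at most
`θ K x ^ (1 - α) ‖Y‖ ^ α`, hence at most a small multiple of `‖Y‖ ^ α`; off it, `1 / θ ≤ x < ‖Y‖`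
bounds the error. So the remainders are dominated by a multiple of `‖Y‖² exp (c / 2 ‖Y‖ ^ α)`. -/
theorem tendsto_truncated_expMoment {Ω E : Type*} [MeasurableSpace Ω] {P : Measure Ω}
    [IsProbabilityMeasure P] [NormedAddCommGroup E] [MeasurableSpace E] [BorelSpace E]
    {Y : Ω → E} (hY : Measurable Y)
    {α c : ℝ} (hα1 : α < 1) (hc : 0 < c)
    (hint : Integrable (fun ω => ‖Y ω‖ ^ 2 * Real.exp (c / 2 * ‖Y ω‖ ^ α)) P)
    {u : Ω → ℝ} (hu : Measurable u) {K : ℝ} (hK : 0 ≤ K) (huK : ∀ ω, |u ω| ≤ K * ‖Y ω‖)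
    (huint : Integrable u P) (hu0 : ∫ ω, u ω ∂P = 0)
    {x θ : ℕ → ℝ} (hθ0 : ∀ᶠ N in atTop, 0 < θ N) (hθ : Tendsto θ atTop (𝓝 0))
    (hx : Tendsto x atTop atTop) (hθx : ∀ᶠ N in atTop, 1 / θ N ≤ x N)
    (hxθ : Tendsto (fun N => θ N * x N ^ (1 - α)) atTop (𝓝 0)) :
    Tendsto (fun N => ((∫ ω in {ω | ‖Y ω‖ ≤ x N}, Real.exp (θ N * u ω) ∂P) - 1) / θ N ^ 2)
      atTop (𝓝 (1 / 2 * ∫ ω, u ω ^ 2 ∂P)) := by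
  have hms : ∀ r : ℝ, MeasurableSet {ω | ‖Y ω‖ ≤ r} := fun r =>
    measurableSet_le hY.norm measurable_const
  have hme : ∀ r : ℝ, Measurable fun ω => Real.exp (r * u ω) := fun r =>
    Real.measurable_exp.comp (measurable_const.mul hu)
  set F : ℕ → Ω → ℝ := fun N ω =>
    ({ω | ‖Y ω‖ ≤ x N}.indicator (fun ω => Real.exp (θ N * u ω)) ω - 1 - θ N * u ω) / θ N ^ 2
    with hF
  have hFm : ∀ N, Measurable (F N) := fun N =>
    ((((hme _).indicator (hms _)).sub measurable_const).sub
      (measurable_const.mul hu)).div_const _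
  have hsmall : ∀ᶠ N in atTop, θ N * x N ^ (1 - α) * K ≤ c / 2 := by
    have : Tendsto (fun N => θ N * x N ^ (1 - α) * K) atTop (𝓝 (0 * K)) := hxθ.mul_const K
    rw [zero_mul] at this
    exact (this.eventually_lt_const (by linarith : (0 : ℝ) < c / 2)).mono fun _ => le_of_lt
  have hexp : ∀ N, 0 < θ N → θ N * x N ^ (1 - α) * K ≤ c / 2 → ∀ ω, ‖Y ω‖ ≤ x N →
      θ N * |u ω| ≤ c / 2 * ‖Y ω‖ ^ α := by
    intro N hN hs ω hω
    have hsplit : ‖Y ω‖ = ‖Y ω‖ ^ (1 - α) * ‖Y ω‖ ^ α := by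
      rw [← Real.rpow_add' (norm_nonneg _) (by norm_num)]
      simp
    calc θ N * |u ω| ≤ θ N * (K * ‖Y ω‖) := by gcongr; exact huK ω
      _ = θ N * ‖Y ω‖ ^ (1 - α) * K * ‖Y ω‖ ^ α := by
          nth_rewrite 1 [hsplit]; ring
      _ ≤ θ N * x N ^ (1 - α) * K * ‖Y ω‖ ^ α := by
          have : ‖Y ω‖ ^ (1 - α) ≤ x N ^ (1 - α) :=
            Real.rpow_le_rpow (norm_nonneg _) hω (by linarith)
          gcongr
      _ ≤ _ := by gcongr
  have hone : ∀ ω, 1 ≤ Real.exp (c / 2 * ‖Y ω‖ ^ α) := fun ω =>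
    Real.one_le_exp (by positivity)
  have hlim : Tendsto (fun N => ∫ ω, F N ω ∂P) atTop (𝓝 (∫ ω, u ω ^ 2 / 2 ∂P)) := by
    refine tendsto_integral_filter_of_dominated_convergence
      (fun ω => (K ^ 2 + (1 + K)) * (‖Y ω‖ ^ 2 * Real.exp (c / 2 * ‖Y ω‖ ^ α)))
      (Eventually.of_forall fun N => (hFm N).aestronglyMeasurable) ?_ (hint.const_mul _)
      (Eventually.of_forall fun ω => ?_)
    · filter_upwards [hθ0, hθx, hsmall] with N hN hNx hs
      refine Eventually.of_forall fun ω => ?_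
      have hY2 : 0 ≤ ‖Y ω‖ ^ 2 := by positivity
      have hE := hone ω
      rw [hF, Real.norm_eq_abs, abs_div, abs_of_pos (pow_pos hN 2), div_le_iff₀ (pow_pos hN 2)]
      by_cases hω : ‖Y ω‖ ≤ x N
      · rw [Set.indicator_of_mem (show ω ∈ {ω | ‖Y ω‖ ≤ x N} from hω)]
        have h1 := abs_exp_sub_one_sub_le (θ N * u ω)
        rw [abs_mul (θ N), abs_of_pos hN] at h1
        have h2 : u ω ^ 2 ≤ K ^ 2 * ‖Y ω‖ ^ 2 := by
          rw [← mul_pow, ← sq_abs (u ω)]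
          exact pow_le_pow_left₀ (abs_nonneg _) (huK ω) 2
        calc |Real.exp (θ N * u ω) - 1 - θ N * u ω|
            ≤ (θ N * u ω) ^ 2 * Real.exp (θ N * |u ω|) := h1
          _ ≤ (θ N * u ω) ^ 2 * Real.exp (c / 2 * ‖Y ω‖ ^ α) := by
              exact mul_le_mul_of_nonneg_left (Real.exp_le_exp.2 (hexp N hN hs ω hω))
                (sq_nonneg _)
          _ = u ω ^ 2 * Real.exp (c / 2 * ‖Y ω‖ ^ α) * θ N ^ 2 := by ring
          _ ≤ (K ^ 2 * ‖Y ω‖ ^ 2) * Real.exp (c / 2 * ‖Y ω‖ ^ α) * θ N ^ 2 := by gcongr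
          _ ≤ _ := by
              have : 0 ≤ (1 + K) * (‖Y ω‖ ^ 2 * Real.exp (c / 2 * ‖Y ω‖ ^ α)) * θ N ^ 2 := by
                positivity
              linarith
      · rw [Set.indicator_of_notMem (show ω ∉ {ω | ‖Y ω‖ ≤ x N} from hω)]
        have hr : 1 ≤ ‖Y ω‖ * θ N := by
          have := hNx.trans (not_le.1 hω).le
          rwa [div_le_iff₀ hN] at this
        have h1 : |0 - 1 - θ N * u ω| ≤ 1 + θ N * (K * ‖Y ω‖) := by
          have h2 : |0 - 1 - θ N * u ω| ≤ |(0 : ℝ) - 1| + |θ N * u ω| := abs_sub _ _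
          rw [abs_mul (θ N), abs_of_pos hN] at h2
          norm_num at h2
          have := mul_le_mul_of_nonneg_left (huK ω) hN.le
          norm_num
          linarith
        set R := ‖Y ω‖ * θ N with hR
        calc |0 - 1 - θ N * u ω| ≤ 1 + θ N * (K * ‖Y ω‖) := h1
          _ = 1 + K * R := by rw [hR]; ring
          _ ≤ R ^ 2 + K * R ^ 2 := by
              have : R ≤ R ^ 2 := by nlinarith
              have := mul_le_mul_of_nonneg_left this hK
              nlinarith
          _ = (1 + K) * (‖Y ω‖ ^ 2 * 1) * θ N ^ 2 := by rw [hR]; ring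
          _ ≤ (1 + K) * (‖Y ω‖ ^ 2 * Real.exp (c / 2 * ‖Y ω‖ ^ α)) * θ N ^ 2 := by gcongr
          _ ≤ _ := by
              have : 0 ≤ K ^ 2 * (‖Y ω‖ ^ 2 * Real.exp (c / 2 * ‖Y ω‖ ^ α)) * θ N ^ 2 := by
                positivity
              linarith
    · refine (tendsto_exp_second_order (u ω) hθ0 hθ).congr' ?_
      filter_upwards [hx.eventually_ge_atTop ‖Y ω‖] with N hN
      rw [hF]
      simp only
      rw [Set.indicator_of_mem (show ω ∈ {ω | ‖Y ω‖ ≤ x N} from hN)]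
  rw [show 1 / 2 * ∫ ω, u ω ^ 2 ∂P = ∫ ω, u ω ^ 2 / 2 ∂P by rw [integral_div]; ring]
  refine hlim.congr' ?_
  filter_upwards [hθ0, hsmall] with N hN hs
  have hI : Integrable ({ω | ‖Y ω‖ ≤ x N}.indicator fun ω => Real.exp (θ N * u ω)) P :=
    (integrableOn_exp_of_norm_le hY hu hK huK _ _).integrable_indicator (hms _)
  have hI1 : Integrable (fun ω => {ω | ‖Y ω‖ ≤ x N}.indicator
      (fun ω => Real.exp (θ N * u ω)) ω - 1) P := hI.sub (integrable_const 1)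
  rw [integral_div, integral_sub hI1 (huint.const_mul _),
    integral_sub hI (integrable_const 1), integral_const_mul, hu0, integral_indicator (hms _)]
  simp

/-- If `m N = 1 + θ N ^ 2 (a + o(1))`, then `m N ^ N = exp (N θ N ^ 2 (a + o(1)))`. -/
theorem eventually_pow_mem_Icc {m θ : ℕ → ℝ} {a : ℝ} (hθ0 : ∀ᶠ N in atTop, 0 < θ N)
    (hθ : Tendsto θ atTop (𝓝 0))
    (hm : Tendsto (fun N => (m N - 1) / θ N ^ 2) atTop (𝓝 a)) {ε : ℝ} (hε : 0 < ε) :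
    ∀ᶠ N : ℕ in atTop, m N ^ N ∈ Set.Icc (Real.exp (N * θ N ^ 2 * (a - ε)))
      (Real.exp (N * θ N ^ 2 * (a + ε))) := by
  have hm1 : Tendsto m atTop (𝓝 1) := by
    have h : Tendsto (fun N => (m N - 1) / θ N ^ 2 * θ N ^ 2 + 1) atTop (𝓝 (a * 0 ^ 2 + 1)) :=
      (hm.mul (hθ.pow 2)).add_const 1
    rw [zero_pow two_ne_zero, mul_zero, zero_add] at h
    refine h.congr' ?_
    filter_upwards [hθ0] with N hN
    field_simp
    ring
  have hinv : Tendsto (fun N => (m N - 1) / θ N ^ 2 * (m N)⁻¹) atTop (𝓝 a) := by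
    simpa using hm.mul (hm1.inv₀ one_ne_zero)
  filter_upwards [hθ0, hm1.eventually_const_lt (show (0 : ℝ) < 1 by norm_num),
    hm.eventually_lt_const (show a < a + ε by linarith),
    hinv.eventually_const_lt (show a - ε < a by linarith)] with N hN hmN h1 h2
  have hpow : m N ^ N = Real.exp (N * Real.log (m N)) := by
    rw [Real.exp_nat_mul, Real.exp_log hmN]
  have hsq := pow_pos hN 2
  rw [hpow]
  constructor
  · refine Real.exp_le_exp.2 ?_
    rw [mul_assoc]
    refine mul_le_mul_of_nonneg_left ?_ (Nat.cast_nonneg N)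
    refine le_trans ?_ (Real.one_sub_inv_le_log_of_pos hmN)
    calc θ N ^ 2 * (a - ε) ≤ θ N ^ 2 * ((m N - 1) / θ N ^ 2 * (m N)⁻¹) := by gcongr
      _ = 1 - (m N)⁻¹ := by field_simp
  · refine Real.exp_le_exp.2 ?_
    rw [mul_assoc]
    refine mul_le_mul_of_nonneg_left ?_ (Nat.cast_nonneg N)
    refine (Real.log_le_sub_one_of_pos hmN).trans ?_
    calc m N - 1 = θ N ^ 2 * ((m N - 1) / θ N ^ 2) := by field_simp
      _ ≤ _ := by gcongr

/-! ### Covariance matrices and linear functionals -/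

section Covariance

variable {Ω : Type*} [MeasurableSpace Ω] {P : Measure Ω} {k : ℕ}
  {Y : Ω → EuclideanSpace ℝ (Fin k)}

theorem abs_dotProduct_ofLp_le (l : Fin k → ℝ) (y : EuclideanSpace ℝ (Fin k)) :
    |l ⬝ᵥ y.ofLp| ≤ ‖WithLp.toLp 2 l‖ * ‖y‖ := by
  have h := abs_real_inner_le_norm (WithLp.toLp 2 l) y
  rwa [EuclideanSpace.inner_eq_star_dotProduct, dotProduct_comm, star_trivial] at h

theorem integral_dotProduct_ofLp (hY : Integrable Y P) (l : Fin k → ℝ) :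
    ∫ ω, l ⬝ᵥ (Y ω).ofLp ∂P = l ⬝ᵥ (∫ ω, Y ω ∂P).ofLp := by
  have h := integral_inner (𝕜 := ℝ) hY (WithLp.toLp 2 l)
  simp only [EuclideanSpace.inner_eq_star_dotProduct, star_trivial] at h
  simpa only [dotProduct_comm l] using h

variable [IsProbabilityMeasure P]

theorem dotProduct_covMatrix_mulVec (hY : MemLp Y 2 P) (l : Fin k → ℝ) :
    l ⬝ᵥ (covMatrix P Y *ᵥ l) = Var[fun ω => l ⬝ᵥ (Y ω).ofLp; P] := by
  have hm : ∀ i, MemLp (fun ω => l i * Y ω i) 2 P := fun i => (hY.eval_piLp i).const_mul _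
  have hsum : MemLp (fun ω => ∑ i, l i * Y ω i) 2 P := memLp_finsetSum _ fun i _ => hm i
  have : Var[fun ω => l ⬝ᵥ (Y ω).ofLp; P] = Var[fun ω => ∑ i, l i * Y ω i; P] := rfl
  rw [this, ← covariance_self hsum.aestronglyMeasurable.aemeasurable,
    covariance_fun_sum_fun_sum hm hm]
  simp only [covariance_const_mul_left, covariance_const_mul_right, dotProduct, Matrix.mulVec,
    covMatrix, Matrix.of_apply, Finset.mul_sum]
  refine Finset.sum_congr rfl fun i _ => Finset.sum_congr rfl fun j _ => ?_
  ring

theorem posSemidef_covMatrix (hY : MemLp Y 2 P) : (covMatrix P Y).PosSemidef := by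
  refine Matrix.PosSemidef.of_dotProduct_mulVec_nonneg ?_ fun l => ?_
  · ext i j
    simp only [Matrix.conjTranspose_apply, star_trivial, covMatrix, Matrix.of_apply]
    exact covariance_comm _ _
  · rw [star_trivial, dotProduct_covMatrix_mulVec hY]
    exact variance_nonneg _ _

theorem memLp_two_of_stretchedExp_tail (hY : Measurable Y) {α c : ℝ} (hα : 0 < α) (hc : 0 < c)
    (htail : ∀ᶠ t : ℝ in atTop, P.real {ω | t ≤ ‖Y ω‖} ≤ Real.exp (-c * t ^ α)) :
    MemLp Y 2 P := by
  rw [memLp_two_iff_integrable_sq_norm hY.aestronglyMeasurable]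
  refine (integrable_sq_mul_exp_rpow_norm hY hα (half_pos hc) (half_lt_self hc) htail).mono'
    (hY.norm.pow_const 2).aestronglyMeasurable (Eventually.of_forall fun ω => ?_)
  rw [Real.norm_of_nonneg (by positivity)]
  exact le_mul_of_one_le_right (by positivity) (Real.one_le_exp (by positivity))

end Covariance

/-! ### The moderate deviation scaling -/

section Scaling

variable {α : ℝ} {x : ℕ → ℝ}

theorem tendsto_speed_atTop (hx : ∀ N : ℕ, 1 ≤ N → 0 < x N)
    (hx_lower : Tendsto (fun N : ℕ => Real.sqrt (N : ℝ) / x N) atTop (𝓝 0)) :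
    Tendsto (fun N : ℕ => x N ^ 2 / (N : ℝ)) atTop atTop := by
  have h1 : Tendsto (fun N : ℕ => (Real.sqrt (N : ℝ) / x N)⁻¹) atTop atTop := by
    refine tendsto_inv_nhdsGT_zero.comp (tendsto_nhdsWithin_iff.2 ⟨hx_lower, ?_⟩)
    filter_upwards [eventually_ge_atTop 1] with N hN
    exact div_pos (Real.sqrt_pos.2 (by exact_mod_cast hN)) (hx N hN)
  refine (h1.atTop_mul_atTop₀ h1).congr fun N => ?_
  rw [inv_div, ← pow_two, div_pow, Real.sq_sqrt (Nat.cast_nonneg N)]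

theorem eventually_natCast_le_sq (hx : ∀ N : ℕ, 1 ≤ N → 0 < x N)
    (hx_lower : Tendsto (fun N : ℕ => Real.sqrt (N : ℝ) / x N) atTop (𝓝 0)) :
    ∀ᶠ N : ℕ in atTop, (N : ℝ) ≤ x N ^ 2 := by
  filter_upwards [(tendsto_speed_atTop hx hx_lower).eventually_ge_atTop 1,
    eventually_ge_atTop 1] with N hN hN1
  rwa [le_div_iff₀ (by exact_mod_cast hN1), one_mul] at hN

theorem tendsto_scale_atTop (hx : ∀ N : ℕ, 1 ≤ N → 0 < x N)
    (hx_lower : Tendsto (fun N : ℕ => Real.sqrt (N : ℝ) / x N) atTop (𝓝 0)) :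
    Tendsto x atTop atTop := by
  refine tendsto_atTop_mono' atTop ?_
    (Real.tendsto_sqrt_atTop.comp tendsto_natCast_atTop_atTop)
  filter_upwards [eventually_natCast_le_sq hx hx_lower, eventually_ge_atTop 1] with N hN hN1
  exact Real.sqrt_le_iff.2 ⟨(hx N hN1).le, hN⟩

/-- The upper growth condition on `x` says that `x ^ (2 - α) / N → 0`. -/
theorem tendsto_tilt_mul_rpow (hα1 : α < 1) (hx : ∀ N : ℕ, 1 ≤ N → 0 < x N)
    (hx_upper : Tendsto (fun N : ℕ => x N / (N : ℝ) ^ (1 / (2 - α))) atTop (𝓝 0)) :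
    Tendsto (fun N : ℕ => x N / (N : ℝ) * x N ^ (1 - α)) atTop (𝓝 0) := by
  have h2 : 0 < 2 - α := by linarith
  have h := hx_upper.rpow_const (p := 2 - α) (Or.inr h2.le)
  rw [Real.zero_rpow h2.ne'] at h
  refine h.congr' ?_
  filter_upwards [eventually_ge_atTop 1] with N hN
  have hxN := hx N hN
  rw [Real.div_rpow hxN.le (by positivity), ← Real.rpow_mul (Nat.cast_nonneg N),
    one_div_mul_cancel h2.ne', Real.rpow_one, show 2 - α = 1 + (1 - α) by ring,
    Real.rpow_add hxN, Real.rpow_one]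
  ring

theorem tendsto_tilt (hα1 : α < 1) (hx : ∀ N : ℕ, 1 ≤ N → 0 < x N)
    (hx_lower : Tendsto (fun N : ℕ => Real.sqrt (N : ℝ) / x N) atTop (𝓝 0))
    (hx_upper : Tendsto (fun N : ℕ => x N / (N : ℝ) ^ (1 / (2 - α))) atTop (𝓝 0)) :
    Tendsto (fun N : ℕ => x N / (N : ℝ)) atTop (𝓝 0) := by
  refine squeeze_zero' ?_ ?_ (tendsto_tilt_mul_rpow hα1 hx hx_upper)
  · filter_upwards [eventually_ge_atTop 1] with N hN
    exact div_nonneg (hx N hN).le (Nat.cast_nonneg N)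
  · filter_upwards [eventually_ge_atTop 1,
      (tendsto_scale_atTop hx hx_lower).eventually_ge_atTop 1] with N hN h1
    exact le_mul_of_one_le_right (div_nonneg (hx N hN).le (Nat.cast_nonneg N))
      (Real.one_le_rpow h1 (by linarith))

end Scaling

/-! ### Truncated sums -/

section Truncation

variable {Ω : Type*} [MeasurableSpace Ω] {P : Measure Ω} {k : ℕ}
  {X : ℕ → Ω → EuclideanSpace ℝ (Fin k)}

/-- The event that none of the first `N` variables exceeds `r` in norm. -/
def truncationEvent (X : ℕ → Ω → EuclideanSpace ℝ (Fin k)) (r : ℝ) (N : ℕ) : Set Ω :=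
  {ω | ∀ i ∈ Finset.range N, ‖X i ω‖ ≤ r}

theorem measurableSet_truncationEvent (hX : ∀ i, Measurable (X i)) (r : ℝ) (N : ℕ) :
    MeasurableSet (truncationEvent X r N) := by
  rw [truncationEvent, Set.ofPred_forall]
  refine MeasurableSet.iInter fun i => ?_
  rw [Set.ofPred_forall]
  exact MeasurableSet.iInter fun _ => measurableSet_le (hX i).norm measurable_const

/-- The law of `r⁻¹ (X₀ + ⋯ + X_{N-1})` restricted to the truncation event at level `r`. It has mass
at most one, and is not renormalized. -/
noncomputable def truncatedLaw (P : Measure Ω) (X : ℕ → Ω → EuclideanSpace ℝ (Fin k)) (r : ℝ)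
    (N : ℕ) : Measure (EuclideanSpace ℝ (Fin k)) :=
  (P.restrict (truncationEvent X r N)).map fun ω => (1 / r) • ∑ i ∈ Finset.range N, X i ω

theorem measurable_scaledSum (hX : ∀ i, Measurable (X i)) (r : ℝ) (N : ℕ) :
    Measurable fun ω => (1 / r) • ∑ i ∈ Finset.range N, X i ω := by
  fun_prop

theorem truncatedLaw_apply (hX : ∀ i, Measurable (X i)) (r : ℝ) (N : ℕ)
    {A : Set (EuclideanSpace ℝ (Fin k))} (hA : MeasurableSet A) :
    truncatedLaw P X r N A =
      P ({ω | (1 / r) • ∑ i ∈ Finset.range N, X i ω ∈ A} ∩ truncationEvent X r N) := by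
  rw [truncatedLaw, Measure.map_apply (measurable_scaledSum hX r N) hA,
    Measure.restrict_apply (measurable_scaledSum hX r N hA)]
  rfl

/-- Independence factorizes the exponential moments of the truncated law. -/
theorem expMoment_truncatedLaw (hX : ∀ i, Measurable (X i)) (hindep : iIndepFun X P)
    (hident : ∀ i, IdentDistrib (X i) (X 0) P P) (r s : ℝ) (N : ℕ) (l : Fin k → ℝ) :
    expMoment (truncatedLaw P X r N) s l =
      (∫⁻ ω in {ω | ‖X 0 ω‖ ≤ r},
        ENNReal.ofReal (Real.exp (s / r * (l ⬝ᵥ (X 0 ω).ofLp))) ∂P) ^ N := by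
  set φ : EuclideanSpace ℝ (Fin k) → ℝ≥0∞ := {y | ‖y‖ ≤ r}.indicator
    fun y => ENNReal.ofReal (Real.exp (s / r * (l ⬝ᵥ y.ofLp))) with hφ
  have hφm : Measurable φ := (measurable_exp_dotProduct (s / r) l).indicator
    (measurableSet_le measurable_norm measurable_const)
  have hone : ∀ i, ∫⁻ ω, φ (X i ω) ∂P = ∫⁻ ω, φ (X 0 ω) ∂P := fun i =>
    ((hident i).comp hφm).lintegral_eq
  have h0 : ∫⁻ ω, φ (X 0 ω) ∂P = ∫⁻ ω in {ω | ‖X 0 ω‖ ≤ r},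
      ENNReal.ofReal (Real.exp (s / r * (l ⬝ᵥ (X 0 ω).ofLp))) ∂P := by
    rw [← lintegral_indicator (measurableSet_le (hX 0).norm measurable_const)]
    rfl
  have hprod : ∫⁻ ω, ∏ i ∈ Finset.range N, φ (X i ω) ∂P = ∏ i ∈ Finset.range N,
      ∫⁻ ω, φ (X i ω) ∂P :=
    lintegral_prod_eq_prod_lintegral_of_indepFun (Finset.range N) (fun i ω => φ (X i ω))
      (hindep.comp (fun _ => φ) fun _ => hφm) fun i => hφm.comp (hX i)
  rw [← h0, expMoment, truncatedLaw,
    lintegral_map (measurable_exp_dotProduct s l) (measurable_scaledSum hX r N),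
    ← lintegral_indicator (measurableSet_truncationEvent hX r N)]
  calc _ = ∫⁻ ω, ∏ i ∈ Finset.range N, φ (X i ω) ∂P := by
        refine lintegral_congr fun ω => ?_
        by_cases hω : ω ∈ truncationEvent X r N
        · rw [Set.indicator_of_mem hω]
          have : ∀ i ∈ Finset.range N, φ (X i ω) =
              ENNReal.ofReal (Real.exp (s / r * (l ⬝ᵥ (X i ω).ofLp))) := fun i hi =>
            Set.indicator_of_mem (show X i ω ∈ {y | ‖y‖ ≤ r} from hω i hi) _
          rw [Finset.prod_congr rfl this, ← ENNReal.ofReal_prod_of_nonneg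
            fun i _ => (Real.exp_pos _).le, ← Real.exp_sum, ← Finset.mul_sum]
          congr 2
          rw [WithLp.ofLp_smul, WithLp.ofLp_sum, dotProduct_smul, dotProduct_sum, smul_eq_mul]
          ring
        · rw [Set.indicator_of_notMem hω]
          have : ∃ i ∈ Finset.range N, ¬ ‖X i ω‖ ≤ r := by
            by_contra! hcon
            exact hω hcon
          obtain ⟨i, hi, hir⟩ := this
          exact (Finset.prod_eq_zero hi (Set.indicator_of_notMem
            (show X i ω ∉ {y | ‖y‖ ≤ r} from hir) _)).symm
    _ = _ := by
        rw [hprod, Finset.prod_congr rfl fun i _ => hone i, Finset.prod_const, Finset.card_range]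

variable [IsProbabilityMeasure P]

theorem hasQuadraticCumulantLimit_truncatedLaw {α : ℝ} (hα0 : 0 < α) (hα1 : α < 1)
    {x : ℕ → ℝ} (hx : ∀ N : ℕ, 1 ≤ N → 0 < x N)
    (hx_lower : Tendsto (fun N : ℕ => Real.sqrt (N : ℝ) / x N) atTop (𝓝 0))
    (hx_upper : Tendsto (fun N : ℕ => x N / (N : ℝ) ^ (1 / (2 - α))) atTop (𝓝 0))
    (hX : ∀ i, Measurable (X i)) (hindep : iIndepFun X P)
    (hident : ∀ i, IdentDistrib (X i) (X 0) P P) (hcent : ∫ ω, X 0 ω ∂P = 0)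
    {c : ℝ} (hc : 0 < c)
    (htail : ∀ᶠ t : ℝ in atTop, P.real {ω | t ≤ ‖X 0 ω‖} ≤ Real.exp (-c * t ^ α)) :
    HasQuadraticCumulantLimit (covMatrix P (X 0)) (fun N => truncatedLaw P X (x N) N)
      (fun N => x N ^ 2 / (N : ℝ)) := by
  intro l ε hε
  have hL2 := memLp_two_of_stretchedExp_tail (hX 0) hα0 hc htail
  have hL1 : Integrable (X 0) P := hL2.integrable one_le_two
  have hu : Measurable fun ω => l ⬝ᵥ (X 0 ω).ofLp :=
    (continuous_dotProduct_ofLp l).measurable.comp (hX 0)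
  have huK : ∀ ω, |l ⬝ᵥ (X 0 ω).ofLp| ≤ ‖WithLp.toLp 2 l‖ * ‖X 0 ω‖ :=
    fun ω => abs_dotProduct_ofLp_le l _
  have huint : Integrable (fun ω => l ⬝ᵥ (X 0 ω).ofLp) P :=
    (hL1.norm.const_mul _).mono' hu.aestronglyMeasurable (Eventually.of_forall huK)
  have hu0 : ∫ ω, l ⬝ᵥ (X 0 ω).ofLp ∂P = 0 := by
    rw [integral_dotProduct_ofLp hL1, hcent]
    simp
  have hθ0 : ∀ᶠ N : ℕ in atTop, 0 < x N / (N : ℝ) := by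
    filter_upwards [eventually_ge_atTop 1] with N hN
    exact div_pos (hx N hN) (by exact_mod_cast hN)
  have hθx : ∀ᶠ N : ℕ in atTop, 1 / (x N / (N : ℝ)) ≤ x N := by
    filter_upwards [eventually_natCast_le_sq hx hx_lower, eventually_ge_atTop 1] with N hN hN1
    rw [one_div_div, div_le_iff₀ (hx N hN1), ← pow_two]
    exact hN
  have hθ := tendsto_tilt hα1 hx hx_lower hx_upper
  have hm := tendsto_truncated_expMoment (hX 0) hα1 hc
    (integrable_sq_mul_exp_rpow_norm (hX 0) hα0 (half_pos hc) (half_lt_self hc) htail)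
    hu (norm_nonneg _) huK huint hu0 hθ0 hθ (tendsto_scale_atTop hx hx_lower) hθx
    (tendsto_tilt_mul_rpow hα1 hx hx_upper)
  rw [← variance_of_integral_eq_zero hu.aemeasurable hu0, ← dotProduct_covMatrix_mulVec hL2] at hm
  filter_upwards [eventually_pow_mem_Icc hθ0 hθ hm hε, eventually_ge_atTop 1] with N hN hN1
  have hxN := hx N hN1
  have hN0 : (0 : ℝ) < N := by exact_mod_cast hN1
  have hspeed : (N : ℝ) * (x N / N) ^ 2 = x N ^ 2 / N := by field_simp
  have htilt : x N ^ 2 / N / x N = x N / N := by field_simp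
  rw [hspeed] at hN
  rw [expMoment_truncatedLaw hX hindep hident, htilt,
    ← ofReal_integral_eq_lintegral_ofReal
      (integrableOn_exp_of_norm_le (hX 0) hu (norm_nonneg _) huK _ _)
      (Eventually.of_forall fun _ => (Real.exp_pos _).le),
    ← ENNReal.ofReal_pow (integral_nonneg fun _ => (Real.exp_pos _).le)]
  exact ⟨ENNReal.ofReal_le_ofReal hN.1, ENNReal.ofReal_le_ofReal hN.2⟩

/-- The truncation event fails with superexponentially small probability: by the union bound
with probability at most `N exp (-c x ^ α)`, and the speed `x ^ 2 / N` is `o(x ^ α)`. -/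
theorem eventually_measure_truncationEvent_compl_le {α : ℝ} (hα0 : 0 < α) (hα1 : α < 1)
    {x : ℕ → ℝ} (hx : ∀ N : ℕ, 1 ≤ N → 0 < x N)
    (hx_lower : Tendsto (fun N : ℕ => Real.sqrt (N : ℝ) / x N) atTop (𝓝 0))
    (hx_upper : Tendsto (fun N : ℕ => x N / (N : ℝ) ^ (1 / (2 - α))) atTop (𝓝 0))
    (hident : ∀ i, IdentDistrib (X i) (X 0) P P) {c : ℝ} (hc : 0 < c)
    (htail : ∀ᶠ t : ℝ in atTop, P.real {ω | t ≤ ‖X 0 ω‖} ≤ Real.exp (-c * t ^ α)) (b : ℝ) :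
    ∀ᶠ N : ℕ in atTop, P (truncationEvent X (x N) N)ᶜ ≤
      ENNReal.ofReal (Real.exp (x N ^ 2 / (N : ℝ) * -b)) := by
  obtain ⟨C, hC, hCr⟩ := exists_sq_le_const_mul_exp hα0 (half_pos hc)
  have hsmall : ∀ᶠ N : ℕ in atTop, x N / (N : ℝ) * x N ^ (1 - α) * (b + 1) < c / 2 := by
    have := (tendsto_tilt_mul_rpow hα1 hx hx_upper).mul_const (b + 1)
    rw [zero_mul] at this
    exact this.eventually_lt_const (half_pos hc)
  filter_upwards [hsmall, (tendsto_scale_atTop hx hx_lower).eventually htail,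
    eventually_natCast_le_sq hx hx_lower, eventually_ge_atTop 1,
    eventually_const_mul_exp_le (tendsto_speed_atTop hx hx_lower) C (lt_add_one b)]
    with N hs ht hN hN1 hfin
  have hxN := hx N hN1
  have hsub : (truncationEvent X (x N) N)ᶜ ⊆ ⋃ i ∈ Finset.range N, {ω | x N ≤ ‖X i ω‖} := by
    intro ω hω
    have : ∃ i ∈ Finset.range N, x N < ‖X i ω‖ := by
      by_contra! hcon
      exact hω hcon
    obtain ⟨i, hi, hlt⟩ := this
    exact Set.mem_iUnion₂.2 ⟨i, hi, hlt.le⟩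
  have hi : ∀ i, P {ω | x N ≤ ‖X i ω‖} ≤ ENNReal.ofReal (Real.exp (-c * x N ^ α)) := by
    intro i
    have : P {ω | x N ≤ ‖X i ω‖} = P {ω | x N ≤ ‖X 0 ω‖} :=
      (hident i).measure_mem_eq (s := {y | x N ≤ ‖y‖})
        (measurableSet_le measurable_const measurable_norm)
    rw [this, ← ofReal_measureReal]
    exact ENNReal.ofReal_le_ofReal ht
  have hspeed : x N ^ 2 / (N : ℝ) * (b + 1) ≤ c / 2 * x N ^ α := by
    have h1 : x N = x N ^ (1 - α) * x N ^ α := by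
      rw [← Real.rpow_add hxN, sub_add_cancel, Real.rpow_one]
    calc x N ^ 2 / (N : ℝ) * (b + 1) = x N / N * x N * (b + 1) := by ring
      _ = x N / N * x N ^ (1 - α) * (b + 1) * x N ^ α := by nth_rewrite 2 [h1]; ring
      _ ≤ _ := mul_le_mul_of_nonneg_right hs.le (Real.rpow_nonneg hxN.le _)
  calc P (truncationEvent X (x N) N)ᶜ ≤ ∑ i ∈ Finset.range N, P {ω | x N ≤ ‖X i ω‖} :=
        (measure_mono hsub).trans (measure_biUnion_finset_le _ _)
    _ ≤ ∑ _i ∈ Finset.range N, ENNReal.ofReal (Real.exp (-c * x N ^ α)) :=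
        Finset.sum_le_sum fun i _ => hi i
    _ = ENNReal.ofReal (N * Real.exp (-c * x N ^ α)) := by
        rw [Finset.sum_const, nsmul_eq_mul, Finset.card_range,
          ENNReal.ofReal_mul (Nat.cast_nonneg N), ENNReal.ofReal_natCast]
    _ ≤ ENNReal.ofReal (Real.exp (x N ^ 2 / (N : ℝ) * -b)) := by
        refine ENNReal.ofReal_le_ofReal (le_trans ?_ hfin)
        calc N * Real.exp (-c * x N ^ α)
            ≤ C * Real.exp (c / 2 * x N ^ α) * Real.exp (-c * x N ^ α) :=
              mul_le_mul_of_nonneg_right (hN.trans (hCr _ hxN.le)) (Real.exp_pos _).le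
          _ = C * Real.exp (-(c / 2 * x N ^ α)) := by
              rw [mul_assoc, ← Real.exp_add]; congr 2; ring
          _ ≤ C * Real.exp (x N ^ 2 / (N : ℝ) * -(b + 1)) := by
              refine mul_le_mul_of_nonneg_left (Real.exp_le_exp.2 ?_) hC.le
              linarith

end Truncation

end LargeDev

/-! ### The moderate deviation principle -/

open LargeDev in
theorem theoremB {Ω : Type*} [MeasurableSpace Ω] (P : Measure Ω) [IsProbabilityMeasure P]
    (k : ℕ) (α : ℝ) (hα0 : 0 < α) (hα1 : α < 1)
    (x : ℕ → ℝ) (hx : ∀ N : ℕ, 1 ≤ N → 0 < x N)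
    (hx_lower : Tendsto (fun N : ℕ => Real.sqrt (N : ℝ) / x N) atTop (𝓝 0))
    (hx_upper : Tendsto (fun N : ℕ => x N / (N : ℝ) ^ (1 / (2 - α))) atTop (𝓝 0))
    (X : ℕ → Ω → EuclideanSpace ℝ (Fin k))
    (hX_meas : ∀ i, Measurable (X i))
    (hX_indep : iIndepFun X P)
    (hX_ident : ∀ i, IdentDistrib (X i) (X 0) P P)
    (hX_centered : ∫ ω, X 0 ω ∂P = 0)
    (c : ℝ) (hc : 0 < c)
    (hX_tail : ∀ᶠ t : ℝ in atTop, P.real {ω | t ≤ ‖X 0 ω‖} ≤ Real.exp (-c * t ^ α))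
    (hX_cov : IsUnit (LargeDev.covMatrix P (X 0))) :
    LargeDev.IsGoodRateFunction (LargeDev.gaussianRate (LargeDev.covMatrix P (X 0))) ∧
    LargeDev.SatisfiesLDP P (fun N ω => (1 / x N) • ∑ i ∈ Finset.range N, X i ω)
      (fun N => x N ^ 2 / (N : ℝ)) (LargeDev.gaussianRate (LargeDev.covMatrix P (X 0))) ∧
    ∀ t : Fin k → ℝ, (∀ j, 0 < t j) →
      Tendsto
        (fun N : ℕ => (((N : ℝ) / x N ^ 2 : ℝ) : EReal) *
          ENNReal.log (P {ω | ∀ j, t j ≤ ((1 / x N) • ∑ i ∈ Finset.range N, X i ω) j}))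
        atTop
        (𝓝 (-((⨅ z ∈ {z : EuclideanSpace ℝ (Fin k) | ∀ j, t j ≤ z j},
          LargeDev.gaussianRate (LargeDev.covMatrix P (X 0)) z : ℝ≥0∞) : EReal))) := by
  set S := covMatrix P (X 0) with hS_def
  have hS : S.PosSemidef :=
    posSemidef_covMatrix (memLp_two_of_stretchedExp_tail (hX_meas 0) hα0 hc hX_tail)
  set q : EuclideanSpace ℝ (Fin k) → ℝ := fun z => 1 / 2 * (z.ofLp ⬝ᵥ (S⁻¹ *ᵥ z.ofLp)) with hq
  have hq0 : ∀ z, 0 ≤ q z := fun z => inv_quadratic_nonneg hS hX_cov _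
  have hs := tendsto_speed_atTop hx hx_lower
  have hν := hasQuadraticCumulantLimit_truncatedLaw hα0 hα1 hx hx_lower hx_upper hX_meas hX_indep
    hX_ident hX_centered hc hX_tail
  have hlow : ∀ O : Set (EuclideanSpace ℝ (Fin k)), IsOpen O → ∀ z ∈ O, ∀ ε > 0,
      ∀ᶠ N : ℕ in atTop, ENNReal.ofReal (Real.exp (x N ^ 2 / (N : ℝ) * -(q z + ε))) ≤
        P {ω | (1 / x N) • ∑ i ∈ Finset.range N, X i ω ∈ O} := by
    intro O hO z hz ε hε
    filter_upwards [eventually_le_measure_open hS hX_cov hs hν hO hz hε] with N hN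
    rw [truncatedLaw_apply hX_meas _ _ hO.measurableSet] at hN
    exact hN.trans (measure_mono Set.inter_subset_left)
  have hup : ∀ C : Set (EuclideanSpace ℝ (Fin k)), IsClosed C → ∀ b b', b' < b →
      (∀ z ∈ C, b < q z) → ∀ᶠ N : ℕ in atTop,
        P {ω | (1 / x N) • ∑ i ∈ Finset.range N, X i ω ∈ C} ≤
          ENNReal.ofReal (Real.exp (x N ^ 2 / (N : ℝ) * -b')) := by
    intro C hC b b' hb hbC
    obtain ⟨b₁, hb₁, hb₂⟩ := exists_between hb
    filter_upwards [eventually_measure_closed_le hX_cov hs hν hC hb₂ hbC,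
      eventually_measure_truncationEvent_compl_le hα0 hα1 hx hx_lower hx_upper hX_ident hc
        hX_tail b₁, eventually_const_mul_exp_le hs 2 hb₁] with N h1 h2 h3
    rw [truncatedLaw_apply hX_meas _ _ hC.measurableSet] at h1
    refine (measure_le_inter_add_sdiff P _ (truncationEvent X (x N) N)).trans ?_
    refine (add_le_add h1 ((measure_mono fun ω hω => hω.2).trans h2)).trans ?_
    rw [← ENNReal.ofReal_add (Real.exp_pos _).le (Real.exp_pos _).le, ← two_mul]
    exact ENNReal.ofReal_le_ofReal h3
  refine ⟨isGoodRateFunction_gaussianRate hS hX_cov,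
    ⟨hs, (isGoodRateFunction_gaussianRate hS hX_cov).1,
      fun O hO => neg_iInf_le_liminf hs (hlow O hO),
      fun C hC => limsup_le_neg_iInf hq0 hs (hup C hC)⟩, fun t ht => ?_⟩
  have hinv : ∀ N : ℕ, (N : ℝ) / x N ^ 2 = 1 / (x N ^ 2 / (N : ℝ)) :=
    fun N => (one_div_div _ _).symm
  simp only [hinv]
  have hAc : IsClosed {z : EuclideanSpace ℝ (Fin k) | ∀ j, t j ≤ z j} := by
    rw [Set.ofPred_forall]
    exact isClosed_iInter fun j => isClosed_le continuous_const (by fun_prop)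
  refine tendsto_of_le_liminf_of_limsup_le (neg_iInf_le_liminf (q := q) hs fun z hz ε hε => ?_)
    (limsup_le_neg_iInf hq0 hs (hup _ hAc))
  -- Every point of the closed orthant is the limit of points `(1 + η) z` of the open orthant.
  have hOo : IsOpen {z : EuclideanSpace ℝ (Fin k) | ∀ j, t j < z j} := by
    rw [Set.ofPred_forall]
    exact isOpen_iInter_of_finite fun j => isOpen_lt continuous_const (by fun_prop)
  obtain ⟨η, hη, hqη⟩ : ∃ η : ℝ, 0 < η ∧ q ((1 + η) • z) < q z + ε / 2 := by
    have hcont : Continuous fun η : ℝ => q ((1 + η) • z) :=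
      (continuous_inv_quadratic S).comp (by fun_prop)
    have h0 : Tendsto (fun η : ℝ => q ((1 + η) • z)) (𝓝[>] 0) (𝓝 (q z)) := by
      have := (hcont.tendsto 0).mono_left (nhdsWithin_le_nhds (s := Set.Ioi 0))
      simpa using this
    obtain ⟨η, h1, h2⟩ := ((h0.eventually_lt_const (show q z < q z + ε / 2 by linarith)).and
      self_mem_nhdsWithin).exists
    exact ⟨η, h2, h1⟩
  have hmem : (1 + η) • z ∈ {z : EuclideanSpace ℝ (Fin k) | ∀ j, t j < z j} := by
    intro j
    have h1 : t j ≤ z j := hz j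
    have h2 := mul_pos hη ((ht j).trans_le h1)
    rw [PiLp.smul_apply, smul_eq_mul]
    linarith
  filter_upwards [hlow _ hOo _ hmem (ε / 2) (half_pos hε), hs.eventually_ge_atTop 0] with N hN hN0
  refine le_trans (ENNReal.ofReal_le_ofReal (Real.exp_le_exp.2 ?_))
    (hN.trans (measure_mono fun ω hω j => (hω j).le))
  exact mul_le_mul_of_nonneg_left (by linarith) hN0
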